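/- Let $n\in\mathbb{N}$, $k\in\mathbb{N}=\{1,2,\dots\}$ and $1\le p\le\infty$ (with $1/\infty=0$). Let $S_p^k(\mathbb{R}^n)$ be the space of (equivalence classes of) measurable functions $u:\mathbb{R}^n\to\mathbb{R}$ whose weak derivatives $\partial^\alpha u=\frac{\partial^{|\alpha|}u}{\partial x_1^{\alpha_1}\cdots\partial x_n^{\alpha_n}}$ exist and lie in $L_p(\mathbb{R}^n)$ for all multi-indices $\alpha\in\mathbb{Z}_+^n$ with $\alpha_i\le k$ for $i=1,\dots,n$, with the norm \[\|u\|_{S_p^k(\mathbb{R}^n)}=\sum_{\alpha_1,\dots,\alpha_n\le k}\|\partial^\alpha u\|_{L_p(\mathbb{R}^n)}.\] For $m\in\mathbb{Z}_+$ and $0\le\gamma\le1$ let $C^{m,\gamma}(\mathbb{R}^n)$ be the space of $m$ times continuously differentiable functions $v:\mathbb{R}^n\to\mathbb{R}$ with finite norm \[\|v\|_{C^{m,\gamma}(\mathbb{R}^n)}=\sum_{j=0}^m\Big(\sup_{x\in\mathbb{R}^n}|D^jv(x)|+\sup_{x\ne x'}\frac{|D^jv(x)-D^jv(x')|}{|x-x'|^\gamma}\Big),\]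 where $D^jv=\big(\frac{\partial^jv}{\partial x_{i_1}\cdots\partial x_{i_j}}\big)_{i_1,\dots,i_j=1}^n$ and $|\cdot|$ is the Euclidean norm. Then there is a bounded embedding \[S_p^k(\mathbb{R}^n)\hookrightarrow C^{k-1,1-\frac1p}(\mathbb{R}^n),\] that is, there is a constant $C=C(n,k,p)$ such that every $u\in S_p^k(\mathbb{R}^n)$ coincides almost everywhere with a function $v\in C^{k-1,1-\frac1p}(\mathbb{R}^n)$, and $\|v\|_{C^{k-1,1-\frac1p}(\mathbb{R}^n)}\le C\,\|u\|_{S_p^k(\mathbb{R}^n)}$. -/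

import Mathlib

open MeasureTheory
open scoped ENNReal NNReal ContDiff

noncomputable section

namespace DominatingMixed

/-- `ℝⁿ` with the Euclidean norm and Lebesgue measure. -/
abbrev RSpace (n : ℕ) : Type := EuclideanSpace ℝ (Fin n)

/-- The classical first order partial derivative `∂f/∂x_i`. -/
def partialDeriv {n : ℕ} (i : Fin n) (f : RSpace n → ℝ) : RSpace n → ℝ :=
  fun x => fderiv ℝ f x (EuclideanSpace.single i 1)

/-- The classical mixed derivative `∂^|α| f / (∂x_1^{α_1} ⋯ ∂x_n^{α_n})`; it is only used for
smooth `f`. -/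
def mixedDeriv {n : ℕ} (α : Fin n → ℕ) (f : RSpace n → ℝ) : RSpace n → ℝ :=
  (List.finRange n).foldr (fun i g => (partialDeriv i)^[α i] g) f

/-- `g` is a weak derivative `∂^|α| u / (∂x_1^{α_1} ⋯ ∂x_n^{α_n})` of `u` on `ℝⁿ`. -/
structure IsWeakDeriv {n : ℕ} (α : Fin n → ℕ) (u g : RSpace n → ℝ) : Prop where
  locallyIntegrable : LocallyIntegrable u volume
  locallyIntegrable_deriv : LocallyIntegrable g volume
  integral_eq : ∀ φ : RSpace n → ℝ, ContDiff ℝ (∞ : ℕ∞ω) φ → HasCompactSupport φ →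
    ∫ x, u x * mixedDeriv α φ x = (-1) ^ (∑ i, α i) * ∫ x, g x * φ x

/-- The `L_p` norm of the weak derivative of `u` of multi-index `α`. The weak derivative is unique
up to null sets, so the infimum is over a single value if it exists; the value is `∞` if `u` has
no weak derivative of multi-index `α`. -/
def weakDerivNorm {n : ℕ} (α : Fin n → ℕ) (p : ℝ≥0∞) (u : RSpace n → ℝ) : ℝ≥0∞ :=
  ⨅ (g : RSpace n → ℝ) (_ : IsWeakDeriv α u g), eLpNorm g p volume

/-- The norm of the Sobolev space `S_p^𝐤(ℝⁿ)` with dominating mixed derivatives: the sum of the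
`L_p` norms of the weak derivatives with multi-index `α`, `α_i ≤ k_i`. -/
def mixedSobolevNorm {n : ℕ} (k : Fin n → ℕ) (p : ℝ≥0∞) (u : RSpace n → ℝ) : ℝ≥0∞ :=
  ∑ α ∈ Finset.Iic k, weakDerivNorm α p u

/-- `u ∈ S_p^𝐤(ℝⁿ)`: `u` is measurable with finite norm. -/
def MemMixedSobolev {n : ℕ} (k : Fin n → ℕ) (p : ℝ≥0∞) (u : RSpace n → ℝ) : Prop :=
  AEStronglyMeasurable u volume ∧ mixedSobolevNorm k p u < ⊤

/-- The tensor `D^j v(x)` of all partial derivatives `∂^j v / (∂x_{i_1} ⋯ ∂x_{i_j})`, with the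
Euclidean (Frobenius) norm. -/
def derivTensor {n : ℕ} (j : ℕ) (v : RSpace n → ℝ) (x : RSpace n) :
    EuclideanSpace ℝ (Fin j → Fin n) :=
  WithLp.toLp 2 fun I => iteratedFDeriv ℝ j v x fun l => EuclideanSpace.single (I l) 1

/-- The supremum norm, with values in `[0, ∞]`. -/
def supNorm {n : ℕ} {F : Type*} [NormedAddCommGroup F] (f : RSpace n → F) : ℝ≥0∞ :=
  ⨆ x, ‖f x‖ₑ

/-- The norm of `C^{m,γ}(ℝⁿ)`: the sum over `j ≤ m` of the `C^{0,γ}` norms of `D^j v`.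
Here `eHolderNorm γ f` is the Hölder seminorm `sup_{x ≠ x'} |f(x) - f(x')| / |x - x'|^γ`, with
values in `[0, ∞]`. -/
def holderNorm {n : ℕ} (m : ℕ) (γ : ℝ≥0) (v : RSpace n → ℝ) : ℝ≥0∞ :=
  ∑ j ∈ Finset.range (m + 1),
    (supNorm (derivTensor j v) + eHolderNorm γ (derivTensor j v))

/-- `v ∈ C^{m,γ}(ℝⁿ)`: `v` is `m` times continuously differentiable with finite norm. -/
def MemHolderSpace {n : ℕ} (m : ℕ) (γ : ℝ≥0) (v : RSpace n → ℝ) : Prop :=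
  ContDiff ℝ m v ∧ holderNorm m γ v < ⊤

end DominatingMixed

end

noncomputable section

namespace DominatingMixed

open Set Filter Topology
open scoped Convolution

/-! ### Averages over the unit cube -/

/-! For a smooth function of one variable, f(0) is the integral over [0,1] of f(τ) - (1 - τ) f'(τ).
Applied in every coordinate direction, this writes f(x) as an alternating sum, over sets s of
directions, of weighted averages of ∂^s f over the unit box with corner x (`boxAverage_expansion`).
Every derivative that appears is of order at most one in each variable.

The averages make sense for locally integrable functions, are continuous in x, and are bounded by
the L_p norm times |∏ ℓ_i|^(-1/p), where ℓ_i are the side lengths (`enorm_boxAverage_le`). Hence the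
alternating sum built from the weak derivatives, `rep G α`, is a bounded continuous function
whenever α + 1 ≤ k componentwise. Averaging commutes with convolution, and the identity holds for
mollified weak derivatives, so `rep G α` and `G α` have the same mollifications and agree almost
everywhere (`conv_rep`, `rep_ae_eq`).

An increment of `rep G α` by c in direction i is c times the average of the i-th derivative over a
segment. Expanding in the other n - 1 directions turns the segment into a box of volume |c|
(`rep_sub_rep`), and the bound becomes |c| · |c|^(-1/p) = |c|^(1-1/p), the Hölder estimate.

Finally, |α| ≤ k - 1 forces α + 1 ≤ k componentwise. Locally uniform convergence of mollifications
(`hasFDerivAt_rep`) shows that the classical derivatives of `rep G 0` of order up to k - 1 are again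
functions `rep G α`, so both bounds apply to all of them. -/

/-- Lebesgue measure on the unit interval. -/
abbrev unitMeasure : Measure ℝ := volume.restrict (Icc 0 1)

instance : IsProbabilityMeasure unitMeasure := ⟨by simp [unitMeasure]⟩

/-- Lebesgue measure on the unit cube. -/
abbrev cubeMeasure (n : ℕ) : Measure (Fin n → ℝ) := Measure.pi fun _ => unitMeasure

lemma cubeMeasure_eq (n : ℕ) :
    cubeMeasure n = (volume : Measure (Fin n → ℝ)).restrict (univ.pi fun _ => Icc 0 1) := by
  rw [volume_pi, Measure.restrict_pi_pi]

lemma isCompact_cube (n : ℕ) : IsCompact (univ.pi fun _ : Fin n => Icc (0 : ℝ) 1) :=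
  isCompact_univ_pi fun _ => isCompact_Icc

lemma integrable_cube {n : ℕ} {G : (Fin n → ℝ) → ℝ} (hG : Continuous G) :
    Integrable G (cubeMeasure n) := by
  rw [cubeMeasure_eq]
  exact hG.continuousOn.integrableOn_compact (isCompact_cube n)

/-- Resampling one coordinate independently does not change a product of probability measures. This
lets one-variable identities be inserted under the cube integral without splitting off a factor of
the product space. -/
lemma measurePreserving_update {n : ℕ} (i : Fin n) :
    MeasurePreserving (fun z : (Fin n → ℝ) × ℝ => Function.update z.1 i z.2)
      ((cubeMeasure n).prod unitMeasure) (cubeMeasure n) := by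
  have hm : Measurable (fun z : (Fin n → ℝ) × ℝ => Function.update z.1 i z.2) := by
    refine measurable_pi_lambda _ fun j => ?_
    by_cases h : j = i
    · subst h; simpa using measurable_snd
    · simp only [Function.update_of_ne h]; fun_prop
  refine ⟨hm, ?_⟩
  symm
  refine Measure.pi_eq fun s hs => ?_
  rw [Measure.map_apply hm (MeasurableSet.univ_pi hs)]
  -- The old i-th coordinate becomes unconstrained, and its factor in the product measure is the
  -- total mass 1.
  have : (fun z : (Fin n → ℝ) × ℝ => Function.update z.1 i z.2) ⁻¹' (univ.pi s) =
      (univ.pi (Function.update s i univ)) ×ˢ (s i) := by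
    ext z
    simp only [mem_preimage, Set.mem_pi, mem_univ, true_imp_iff, mem_prod]
    constructor
    · intro h
      refine ⟨fun j => ?_, by simpa using h i⟩
      by_cases hj : j = i
      · subst hj; simp
      · simpa [Function.update_of_ne hj] using h j
    · rintro ⟨h1, h2⟩ j
      by_cases hj : j = i
      · subst hj; simpa using h2
      · simpa [Function.update_of_ne hj] using h1 j
  rw [this, Measure.prod_prod, Measure.pi_pi, ← Finset.prod_erase_mul _ _ (Finset.mem_univ i),
    ← Finset.prod_erase_mul (a := i) Finset.univ (fun j => unitMeasure (s j)) (Finset.mem_univ i)]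
  simp only [Function.update_self, measure_univ, mul_one]
  congr 1
  refine Finset.prod_congr rfl fun j hj => ?_
  rw [Function.update_of_ne (Finset.ne_of_mem_erase hj)]

lemma integral_cube_update {n : ℕ} (i : Fin n) {G : (Fin n → ℝ) → ℝ} (hG : Continuous G) :
    ∫ t, G t ∂cubeMeasure n =
      ∫ t, (∫ τ in (0 : ℝ)..1, G (Function.update t i τ)) ∂cubeMeasure n := by
  have hI := integrable_cube hG
  have hmp := measurePreserving_update i
  rw [← hmp.map_eq, integral_map hmp.measurable.aemeasurable, integral_prod]
  · rw [hmp.map_eq]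
    simp only [intervalIntegral.integral_of_le zero_le_one, integral_Icc_eq_integral_Ioc]
  · exact hmp.integrable_comp_of_integrable hI
  · rw [hmp.map_eq]; exact hI.aestronglyMeasurable

/-- The diagonal linear map with entries `ℓ`. -/
def diagMap {n : ℕ} (ℓ t : Fin n → ℝ) : RSpace n := WithLp.toLp 2 fun j => ℓ j * t j

@[simp] lemma diagMap_apply {n : ℕ} (ℓ t : Fin n → ℝ) (j : Fin n) :
    diagMap ℓ t j = ℓ j * t j := rfl

@[fun_prop]
lemma continuous_diagMap {n : ℕ} (ℓ : Fin n → ℝ) : Continuous (diagMap ℓ) :=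
  (PiLp.continuous_toLp 2 _).comp (by fun_prop)

lemma diagMap_update {n : ℕ} {ℓ : Fin n → ℝ} {i : Fin n} (hℓ : ℓ i = 0) (c τ : ℝ)
    (t : Fin n → ℝ) :
    diagMap (Function.update ℓ i c) (Function.update t i τ) =
      diagMap ℓ t + (τ * c) • EuclideanSpace.single i (1 : ℝ) := by
  ext j
  by_cases h : j = i
  · subst h; simp [hℓ, mul_comm]
  · simp [h]

/-- The weight `∏_{i ∈ s} (1 - t_i)`. -/
def cubeWeight {n : ℕ} (s : Finset (Fin n)) (t : Fin n → ℝ) : ℝ := ∏ i ∈ s, (1 - t i)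

@[fun_prop]
lemma continuous_cubeWeight {n : ℕ} (s : Finset (Fin n)) : Continuous (cubeWeight s) := by
  unfold cubeWeight; fun_prop

lemma cubeWeight_insert {n : ℕ} {s : Finset (Fin n)} {i : Fin n} (hi : i ∉ s)
    (t : Fin n → ℝ) : cubeWeight (insert i s) t = (1 - t i) * cubeWeight s t :=
  Finset.prod_insert hi

lemma cubeWeight_update {n : ℕ} {s : Finset (Fin n)} {i : Fin n} (hi : i ∉ s) (t : Fin n → ℝ)
    (τ : ℝ) : cubeWeight s (Function.update t i τ) = cubeWeight s t := by
  refine Finset.prod_congr rfl fun j hj => ?_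
  rw [Function.update_of_ne (by rintro rfl; exact hi hj)]

/-- The weighted average of `g` over the box with corner `x` and sides `ℓ`. -/
def boxAverage {n : ℕ} (κ : (Fin n → ℝ) → ℝ) (ℓ : Fin n → ℝ) (g : RSpace n → ℝ)
    (x : RSpace n) : ℝ :=
  ∫ t, κ t * g (x + diagMap ℓ t) ∂cubeMeasure n

/-- The integrand is the derivative of -(1 - τ) f(τ), which vanishes at τ = 1. The weight 1 - τ is
chosen to kill that endpoint. -/
lemma integral_unit_taylor {f f' : ℝ → ℝ} (hf : ∀ τ, HasDerivAt f (f' τ) τ)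
    (hf' : Continuous f') : ∫ τ in (0 : ℝ)..1, (f τ - (1 - τ) * f' τ) = f 0 := by
  have hc : Continuous f := continuous_iff_continuousAt.2 fun τ => (hf τ).continuousAt
  rw [intervalIntegral.integral_eq_sub_of_hasDerivAt (f := fun τ => -((1 - τ) * f τ))]
  · simp
  · intro τ _
    have h1 : HasDerivAt (fun τ : ℝ => 1 - τ) (-1) τ := by
      simpa using (hasDerivAt_id τ).const_sub 1
    refine HasDerivAt.congr_deriv (h1.mul (hf τ)).neg ?_
    ring
  · exact Continuous.intervalIntegrable (by fun_prop) _ _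

/-- The function `f` has the continuous partial derivative `f'` in direction `i`. -/
structure HasContPartial {n : ℕ} (i : Fin n) (f f' : RSpace n → ℝ) : Prop where
  continuous : Continuous f
  continuous_deriv : Continuous f'
  hasDerivAt : ∀ z τ, HasDerivAt (fun τ : ℝ => f (z + τ • EuclideanSpace.single i 1))
    (f' (z + τ • EuclideanSpace.single i 1)) τ

/-- A box with a vanishing i-th side is opened to length 1 in that direction: `integral_unit_taylor`
is applied along the i-th coordinate for each value of the others, and its factor 1 - τ is absorbed
into the weight. -/
lemma boxAverage_step {n : ℕ} {i : Fin n} {f f' : RSpace n → ℝ} (h : HasContPartial i f f')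
    {s : Finset (Fin n)} (hi : i ∉ s) {ℓ : Fin n → ℝ} (hℓ : ℓ i = 0) (x : RSpace n) :
    boxAverage (cubeWeight s) ℓ f x =
      boxAverage (cubeWeight s) (Function.update ℓ i 1) f x -
        boxAverage (cubeWeight (insert i s)) (Function.update ℓ i 1) f' x := by
  have hf := h.continuous
  have hf' := h.continuous_deriv
  unfold boxAverage
  rw [← integral_sub (integrable_cube (by fun_prop)) (integrable_cube (by fun_prop)),
    integral_cube_update i (by fun_prop)]
  rw [eq_comm, integral_cube_update i (by fun_prop)]
  congr 1
  ext t
  simp only [cubeWeight_insert hi, cubeWeight_update hi, diagMap_update hℓ, Function.update_self, mul_one]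
  have key := integral_unit_taylor (h.hasDerivAt (x + diagMap ℓ t)) (by fun_prop)
  have e : ∀ τ : ℝ, diagMap ℓ (Function.update t i τ) = diagMap ℓ t := by
    intro τ
    ext j
    by_cases hj : j = i
    · subst hj; simp [hℓ]
    · simp [hj]
  simp only [e, intervalIntegral.integral_const, sub_zero, one_smul]
  rw [zero_smul, add_zero] at key
  rw [← key, ← intervalIntegral.integral_const_mul]
  congr 1
  ext τ
  rw [add_assoc]
  ring

/-- Induction on S with `boxAverage_step`. The sides outside S are kept arbitrary: the choice S =
everything represents point values, while S = all directions but one represents increments. -/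
lemma boxAverage_expansion {n : ℕ} {w : Finset (Fin n) → RSpace n → ℝ} (S : Finset (Fin n))
    (hw : ∀ s, s ⊆ S → ∀ i ∈ S, i ∉ s → HasContPartial i (w s) (w (insert i s)))
    (ℓ : Fin n → ℝ) (hℓ : ∀ i ∈ S, ℓ i = 0) (x : RSpace n) :
    boxAverage (cubeWeight ∅) ℓ (w ∅) x =
      ∑ s ∈ S.powerset, (-1) ^ s.card *
        boxAverage (cubeWeight s) (fun j => if j ∈ S then 1 else ℓ j) (w s) x := by
  induction S using Finset.induction_on with
  | empty => simp
  | insert i S hi ih =>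
    rw [ih (fun s hs j hj => hw s (hs.trans (Finset.subset_insert _ _)) j
        (Finset.mem_insert_of_mem hj)) (fun j hj => hℓ j (Finset.mem_insert_of_mem hj)),
      Finset.sum_powerset_insert hi, ← Finset.sum_add_distrib]
    refine Finset.sum_congr rfl fun s hs => ?_
    have hsS := Finset.mem_powerset.1 hs
    have his : i ∉ s := fun h => hi (hsS h)
    have hu : Function.update (fun j => if j ∈ S then (1 : ℝ) else ℓ j) i 1 =
        fun j => if j ∈ insert i S then 1 else ℓ j := by
      ext j
      by_cases hj : j = i
      · subst hj; simp
      · simp [hj]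
    rw [boxAverage_step (hw s (hsS.trans (Finset.subset_insert _ _)) i
      (Finset.mem_insert_self _ _) his) his (by simp [hi, hℓ]), hu,
      Finset.card_insert_of_notMem his]
    ring

lemma boxAverage_zero {n : ℕ} (f : RSpace n → ℝ) (x : RSpace n) :
    boxAverage (cubeWeight ∅) 0 f x = f x := by
  have : ∀ t, diagMap (0 : Fin n → ℝ) t = 0 := fun t => by ext; simp
  simp [boxAverage, cubeWeight, this]

/-- The fundamental theorem of calculus, with the segment regarded as a box having only one nonzero
side. -/
lemma boxAverage_single {n : ℕ} {i : Fin n} {f f' : RSpace n → ℝ} (h : HasContPartial i f f')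
    (c : ℝ) (x : RSpace n) :
    c * boxAverage (cubeWeight ∅) (Pi.single i c) f' x =
      f (x + c • EuclideanSpace.single i 1) - f x := by
  have hf' := h.continuous_deriv
  unfold boxAverage
  rw [integral_cube_update i (by fun_prop)]
  simp only [cubeWeight, Finset.prod_empty, one_mul]
  have e : ∀ (t : Fin n → ℝ) (τ : ℝ), diagMap (Pi.single i c) (Function.update t i τ) =
      (τ * c) • EuclideanSpace.single i (1 : ℝ) := by
    intro t τ
    ext j
    by_cases hj : j = i
    · subst hj; simp [mul_comm]
    · simp [hj]
  simp only [e, integral_const, probReal_univ, one_smul]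
  rw [← intervalIntegral.integral_const_mul,
    intervalIntegral.integral_eq_sub_of_hasDerivAt
      (f := fun τ : ℝ => f (x + (τ * c) • EuclideanSpace.single i 1))]
  · simp
  · intro τ _
    have := (h.hasDerivAt x (τ * c)).comp τ ((hasDerivAt_id τ).mul_const c)
    simpa [mul_comm, Function.comp_def] using this
  · exact Continuous.intervalIntegrable (by fun_prop) _ _

/-! ### Box averages of rough functions -/

lemma map_diagMap_volume {n : ℕ} {ℓ : Fin n → ℝ} (hℓ : ∀ i, ℓ i ≠ 0) (x : RSpace n) :
    (volume : Measure (Fin n → ℝ)).map (fun t => x + diagMap ℓ t) =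
      ENNReal.ofReal |∏ i, ℓ i|⁻¹ • volume := by
  have hdet : (Matrix.diagonal ℓ).det ≠ 0 := by
    rw [Matrix.det_diagonal]; exact Finset.prod_ne_zero_iff.2 fun i _ => hℓ i
  have h1 := Real.map_matrix_volume_pi_eq_smul_volume_pi hdet
  have hcomp : (fun t => x + diagMap ℓ t) =
      (fun z => x + z) ∘ (WithLp.toLp 2 : (Fin n → ℝ) → RSpace n) ∘
        (Matrix.toLin' (Matrix.diagonal ℓ)) := by
    ext t j
    simp [Matrix.mulVec_diagonal]
  have hm : Measurable (Matrix.toLin' (Matrix.diagonal ℓ)) :=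
    (LinearMap.continuous_of_finiteDimensional _).measurable
  have hm2 : Measurable (WithLp.toLp 2 : (Fin n → ℝ) → RSpace n) :=
    (PiLp.continuous_toLp 2 _).measurable
  rw [hcomp, ← Measure.map_map (by fun_prop) (hm2.comp hm), ← Measure.map_map hm2 hm, h1,
    Measure.map_smul, Measure.map_smul, (PiLp.volume_preserving_toLp (Fin n)).map_eq,
    map_add_left_eq_self, Matrix.det_diagonal, abs_inv]

/-- Retaining the restriction to the compact image of the cube makes local integrability sufficient
for box averages to exist. -/
lemma map_cube_le {n : ℕ} {ℓ : Fin n → ℝ} (hℓ : ∀ i, ℓ i ≠ 0) (x : RSpace n) :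
    (cubeMeasure n).map (fun t => x + diagMap ℓ t) ≤
      ENNReal.ofReal |∏ i, ℓ i|⁻¹ • volume.restrict
        ((fun t => x + diagMap ℓ t) '' univ.pi fun _ => Icc 0 1) := by
  have hc : Continuous (fun t => x + diagMap ℓ t) := by fun_prop
  have hK := ((isCompact_cube n).image hc).measurableSet
  rw [← Measure.restrict_smul, ← map_diagMap_volume hℓ x, cubeMeasure_eq]
  refine Measure.le_iff.2 fun s hs => ?_
  rw [Measure.map_apply hc.measurable hs, Measure.restrict_apply hs,
    Measure.map_apply hc.measurable (hs.inter hK),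
    Measure.restrict_apply (hc.measurable hs)]
  exact measure_mono fun t ht => ⟨ht.1, mem_image_of_mem _ ht.2⟩

lemma map_cube_le_volume {n : ℕ} {ℓ : Fin n → ℝ} (hℓ : ∀ i, ℓ i ≠ 0) (x : RSpace n) :
    (cubeMeasure n).map (fun t => x + diagMap ℓ t) ≤
      ENNReal.ofReal |∏ i, ℓ i|⁻¹ • volume :=
  (map_cube_le hℓ x).trans (by gcongr; exact Measure.restrict_le_self)

lemma aestronglyMeasurable_comp_diagMap {n : ℕ} {ℓ : Fin n → ℝ} (hℓ : ∀ i, ℓ i ≠ 0)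
    {g : RSpace n → ℝ} (hg : AEStronglyMeasurable g) (x : RSpace n) :
    AEStronglyMeasurable (fun t => g (x + diagMap ℓ t)) (cubeMeasure n) := by
  have hc : Continuous (fun t => x + diagMap ℓ t) := by fun_prop
  refine AEStronglyMeasurable.comp_measurable (g := g) ?_ hc.measurable
  refine hg.mono_ac ?_
  exact (Measure.absolutelyContinuous_of_le (map_cube_le_volume hℓ x)).trans
    Measure.smul_absolutelyContinuous

lemma integrable_comp_diagMap {n : ℕ} {ℓ : Fin n → ℝ} (hℓ : ∀ i, ℓ i ≠ 0)
    {g : RSpace n → ℝ} (hg : LocallyIntegrable g) (x : RSpace n) :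
    Integrable (fun t => g (x + diagMap ℓ t)) (cubeMeasure n) := by
  have hc : Continuous (fun t => x + diagMap ℓ t) := by fun_prop
  refine Integrable.comp_measurable (g := g) ?_ hc.measurable
  refine Integrable.mono_measure ?_ (map_cube_le hℓ x)
  exact (hg.integrableOn_isCompact ((isCompact_cube n).image hc)).smul_measure
    ENNReal.ofReal_ne_top

lemma ae_mem_cube (n : ℕ) : ∀ᵐ t ∂cubeMeasure n, t ∈ univ.pi fun _ : Fin n => Icc (0 : ℝ) 1 := by
  rw [cubeMeasure_eq]
  exact ae_restrict_mem (isCompact_cube n).measurableSet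

lemma abs_cubeWeight_le {n : ℕ} (s : Finset (Fin n)) :
    ∀ᵐ t ∂cubeMeasure n, |cubeWeight s t| ≤ 1 := by
  filter_upwards [ae_mem_cube n] with t ht
  rw [cubeWeight, Finset.abs_prod]
  refine Finset.prod_le_one (fun _ _ => abs_nonneg _) fun i _ => ?_
  have := ht i (mem_univ i)
  rw [abs_le]
  constructor <;> linarith [this.1, this.2]

lemma integrable_weight_mul {n : ℕ} (s : Finset (Fin n)) {ℓ : Fin n → ℝ} (hℓ : ∀ i, ℓ i ≠ 0)
    {g : RSpace n → ℝ} (hg : LocallyIntegrable g) (x : RSpace n) :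
    Integrable (fun t => cubeWeight s t * g (x + diagMap ℓ t)) (cubeMeasure n) :=
  (integrable_comp_diagMap hℓ hg x).bdd_mul (c := 1)
    (continuous_cubeWeight s).aestronglyMeasurable (by simpa using abs_cubeWeight_le s)

/-- The weight is at most 1 on the cube, the L_1 norm is at most the L_p norm for a probability
measure, and the Jacobian of the change of variables enters with power 1/p. This power is the source
of the Hölder exponent. -/
lemma enorm_boxAverage_le {n : ℕ} (s : Finset (Fin n)) {ℓ : Fin n → ℝ} (hℓ : ∀ i, ℓ i ≠ 0)
    {g : RSpace n → ℝ} (hg : AEStronglyMeasurable g) {p : ℝ≥0∞} (hp : 1 ≤ p) (x : RSpace n) :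
    ‖boxAverage (cubeWeight s) ℓ g x‖ₑ ≤
      ENNReal.ofReal |∏ i, ℓ i|⁻¹ ^ (1 / p).toReal * eLpNorm g p := by
  have hc : Continuous (fun t => x + diagMap ℓ t) := by fun_prop
  have hm := aestronglyMeasurable_comp_diagMap hℓ hg x
  have h1 : ‖boxAverage (cubeWeight s) ℓ g x‖ₑ ≤
      ∫⁻ t, ‖cubeWeight s t * g (x + diagMap ℓ t)‖ₑ ∂cubeMeasure n :=
    enorm_integral_le_lintegral_enorm _
  have h2 : ∫⁻ t, ‖cubeWeight s t * g (x + diagMap ℓ t)‖ₑ ∂cubeMeasure n ≤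
      eLpNorm (fun t => g (x + diagMap ℓ t)) 1 (cubeMeasure n) := by
    rw [eLpNorm_one_eq_lintegral_enorm]
    refine lintegral_mono_ae ?_
    filter_upwards [abs_cubeWeight_le s] with t ht
    rw [enorm_le_iff_norm_le, norm_mul, Real.norm_eq_abs]
    exact mul_le_of_le_one_left (norm_nonneg _) ht
  have h3 : eLpNorm (fun t => g (x + diagMap ℓ t)) 1 (cubeMeasure n) ≤
      eLpNorm (fun t => g (x + diagMap ℓ t)) p (cubeMeasure n) :=
    eLpNorm_le_eLpNorm_of_exponent_le hp hm
  have hac : (cubeMeasure n).map (fun t => x + diagMap ℓ t) ≪ volume :=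
    (Measure.absolutelyContinuous_of_le (map_cube_le_volume hℓ x)).trans
      Measure.smul_absolutelyContinuous
  have h4 : eLpNorm (fun t => g (x + diagMap ℓ t)) p (cubeMeasure n) =
      eLpNorm g p ((cubeMeasure n).map fun t => x + diagMap ℓ t) :=
    (eLpNorm_map_measure (hg.mono_ac hac) hc.aemeasurable).symm
  have hpos : ENNReal.ofReal |∏ i, ℓ i|⁻¹ ≠ 0 := by
    have : ∏ i, ℓ i ≠ 0 := Finset.prod_ne_zero_iff.2 fun i _ => hℓ i
    simp only [ne_eq, ENNReal.ofReal_eq_zero, not_le]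
    positivity
  have h5 := eLpNorm_mono_measure (p := p) g (map_cube_le_volume hℓ x)
  rw [eLpNorm_smul_measure_of_ne_zero hpos, smul_eq_mul] at h5
  exact h1.trans (h2.trans (h3.trans (h4.trans_le h5)))

lemma continuous_boxAverage_of_continuous {n : ℕ} (s : Finset (Fin n)) (ℓ : Fin n → ℝ)
    {g : RSpace n → ℝ} (hg : Continuous g) : Continuous (boxAverage (cubeWeight s) ℓ g) := by
  unfold boxAverage
  rw [cubeMeasure_eq]
  exact continuous_parametric_integral_of_continuous (by fun_prop) (isCompact_cube n)

/-- By the case p = 1 of `enorm_boxAverage_le`, approximation in L_1 by continuous functions gives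
uniform approximation of the averages. -/
lemma continuous_boxAverage_of_integrable {n : ℕ} (s : Finset (Fin n)) {ℓ : Fin n → ℝ}
    (hℓ : ∀ i, ℓ i ≠ 0) {g : RSpace n → ℝ} (hg : Integrable g) :
    Continuous (boxAverage (cubeWeight s) ℓ g) := by
  refine continuous_of_uniform_approx_of_continuous fun u hu => ?_
  obtain ⟨ε, hε, hu⟩ := Metric.mem_uniformity_dist.1 hu
  set c : ℝ := |∏ i, ℓ i|⁻¹
  have hc : 0 < c := by
    have : ∏ i, ℓ i ≠ 0 := Finset.prod_ne_zero_iff.2 fun i _ => hℓ i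
    positivity
  obtain ⟨h, -, hgh, hcont, hint⟩ :=
    hg.exists_hasCompactSupport_lintegral_sub_le
      (ε := ENNReal.ofReal (c⁻¹ * (ε / 2))) (by simp only [ne_eq, ENNReal.ofReal_eq_zero, not_le]; positivity)
  refine ⟨_, continuous_boxAverage_of_continuous s ℓ hcont, fun x => hu ?_⟩
  have hsub : boxAverage (cubeWeight s) ℓ g x - boxAverage (cubeWeight s) ℓ h x =
      boxAverage (cubeWeight s) ℓ (g - h) x := by
    unfold boxAverage
    rw [← integral_sub (integrable_weight_mul s hℓ hg.locallyIntegrable x)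
      (integrable_weight_mul s hℓ hint.locallyIntegrable x)]
    simp [mul_sub]
  have hb := enorm_boxAverage_le s hℓ (hg.sub hint).aestronglyMeasurable le_rfl x
  rw [← hsub, eLpNorm_one_eq_lintegral_enorm] at hb
  rw [dist_eq_norm]
  have : ‖boxAverage (cubeWeight s) ℓ g x - boxAverage (cubeWeight s) ℓ h x‖ₑ ≤
      ENNReal.ofReal (ε / 2) := by
    refine hb.trans ?_
    calc _ ≤ ENNReal.ofReal c * ENNReal.ofReal (c⁻¹ * (ε / 2)) := by
          simp only [div_one, ENNReal.toReal_one, ENNReal.rpow_one]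
          gcongr
          exact hgh
      _ = ENNReal.ofReal (ε / 2) := by
          rw [← ENNReal.ofReal_mul hc.le]
          congr 1
          field_simp
  rw [← ofReal_norm, ENNReal.ofReal_le_ofReal_iff (by positivity)] at this
  linarith

lemma continuous_boxAverage {n : ℕ} (s : Finset (Fin n)) {ℓ : Fin n → ℝ}
    (hℓ : ∀ i, ℓ i ≠ 0) {g : RSpace n → ℝ} (hg : LocallyIntegrable g) :
    Continuous (boxAverage (cubeWeight s) ℓ g) := by
  refine continuous_iff_continuousAt.2 fun x => ?_
  -- This compact set contains every box whose corner is within distance 1 of x, so cutting `g` off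
  -- outside it does not change the averages near x.
  set K : Set (RSpace n) := (fun z : RSpace n × (Fin n → ℝ) => z.1 + diagMap ℓ z.2) ''
    (Metric.closedBall x 1 ×ˢ univ.pi fun _ => Icc 0 1)
  have hK : IsCompact K :=
    ((isCompact_closedBall x 1).prod (isCompact_cube n)).image (by fun_prop)
  have hi : Integrable (K.indicator g) :=
    (integrable_indicator_iff hK.measurableSet).2 (hg.integrableOn_isCompact hK)
  refine (continuous_boxAverage_of_integrable s hℓ hi).continuousAt.congr ?_
  filter_upwards [Metric.closedBall_mem_nhds x one_pos] with z hz
  refine integral_congr_ae ?_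
  filter_upwards [ae_mem_cube n] with t ht
  rw [indicator_of_mem]
  exact ⟨(z, t), ⟨hz, ht⟩, rfl⟩

/-- The convolution of real functions with respect to Lebesgue measure. -/
abbrev conv {n : ℕ} (φ g : RSpace n → ℝ) : RSpace n → ℝ := φ ⋆[.lsmul ℝ ℝ, volume] g

lemma conv_apply {n : ℕ} (φ g : RSpace n → ℝ) (x : RSpace n) :
    conv φ g x = ∫ y, φ y * g (x - y) := rfl

lemma continuous_conv {n : ℕ} {φ g : RSpace n → ℝ} (hφ : Continuous φ)
    (hφc : HasCompactSupport φ) (hg : LocallyIntegrable g) : Continuous (conv φ g) :=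
  hφc.continuous_convolution_left _ hφ hg

/-- Fubini. Genuine measurability of `g` supplies the joint measurability of the integrand. -/
lemma boxAverage_conv {n : ℕ} (s : Finset (Fin n)) (ℓ : Fin n → ℝ) {φ g : RSpace n → ℝ}
    (hφ : Continuous φ) (hφc : HasCompactSupport φ) (hg : LocallyIntegrable g)
    (hgm : Measurable g) :
    boxAverage (cubeWeight s) ℓ (conv φ g) = conv φ (boxAverage (cubeWeight s) ℓ g) := by
  ext x
  simp only [boxAverage, conv_apply, ← integral_const_mul]
  rw [integral_integral_swap]
  · congr 1
    ext y
    congr 1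
    ext t
    rw [show x + diagMap ℓ t - y = x - y + diagMap ℓ t by abel]
    ring
  · have hmeas : Measurable (Function.uncurry fun (t : Fin n → ℝ) (y : RSpace n) =>
        cubeWeight s t * (φ y * g (x + diagMap ℓ t - y))) := by
      have h1 : Measurable fun z : (Fin n → ℝ) × RSpace n => cubeWeight s z.1 :=
        (by fun_prop : Continuous _).measurable
      have h2 : Measurable fun z : (Fin n → ℝ) × RSpace n => φ z.2 :=
        (by fun_prop : Continuous _).measurable
      have h3 : Measurable fun z : (Fin n → ℝ) × RSpace n => x + diagMap ℓ z.1 - z.2 :=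
        (by fun_prop : Continuous _).measurable
      exact h1.mul (h2.mul (hgm.comp h3))
    rw [integrable_prod_iff hmeas.aestronglyMeasurable]
    constructor
    · refine .of_forall fun t => ?_
      have h : Integrable fun y => φ y * g (x + diagMap ℓ t - y) :=
        hφc.convolutionExists_left (.lsmul ℝ ℝ) hφ hg (x + diagMap ℓ t)
      exact h.const_mul (cubeWeight s t)
    · have hc := continuous_conv (φ := fun y => ‖φ y‖) (g := fun y => ‖g y‖) (by fun_prop)
        hφc.norm (fun z => (hg z).imp fun _ h => ⟨h.1, h.2.norm⟩)
      have := integrable_cube (G := fun t => ‖cubeWeight s t‖ *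
        conv (fun y => ‖φ y‖) (fun y => ‖g y‖) (x + diagMap ℓ t)) (by fun_prop)
      simpa [Function.uncurry, conv_apply, integral_const_mul] using this

/-! ### Mixed derivatives of test functions -/

variable {n : ℕ}

lemma contDiff_partialDeriv (i : Fin n) {f : RSpace n → ℝ} (hf : ContDiff ℝ (∞ : ℕ∞ω) f) :
    ContDiff ℝ (∞ : ℕ∞ω) (partialDeriv i f) :=
  (hf.fderiv_right (m := ∞) (by simp)).clm_apply contDiff_const

lemma hasCompactSupport_partialDeriv (i : Fin n) {f : RSpace n → ℝ} (hf : HasCompactSupport f) :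
    HasCompactSupport (partialDeriv i f) :=
  hf.fderiv_apply ℝ _

lemma partialDeriv_comm (i j : Fin n) {f : RSpace n → ℝ} (hf : ContDiff ℝ (∞ : ℕ∞ω) f) :
    partialDeriv i (partialDeriv j f) = partialDeriv j (partialDeriv i f) := by
  have hd : Differentiable ℝ (fderiv ℝ f) :=
    (hf.fderiv_right (m := ∞) (by simp)).differentiable (by simp)
  have key : ∀ (a b : Fin n) (x : RSpace n), partialDeriv a (partialDeriv b f) x =
      fderiv ℝ (fderiv ℝ f) x (EuclideanSpace.single a 1) (EuclideanSpace.single b 1) := by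
    intro a b x
    unfold partialDeriv
    rw [fderiv_clm_apply (hd x) (differentiableAt_const _)]
    simp
  ext x
  rw [key, key]
  have hs : IsSymmSndFDerivAt ℝ f x :=
    (hf.contDiffAt (x := x)).isSymmSndFDerivAt
      (by rw [minSmoothness_of_isRCLikeNormedField]; exact WithTop.coe_le_coe.2 (le_top : (2 : ℕ∞) ≤ ⊤))
  exact hs.eq _ _

/-- The mixed derivative in the directions of a list. -/
def listDeriv (α : Fin n → ℕ) (l : List (Fin n)) (f : RSpace n → ℝ) : RSpace n → ℝ :=
  l.foldr (fun i g => (partialDeriv i)^[α i] g) f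

lemma iterate_partialDeriv_induction {P : (RSpace n → ℝ) → Prop}
    (hP : ∀ i f, P f → P (partialDeriv i f)) (i : Fin n) (m : ℕ) {f : RSpace n → ℝ} (hf : P f) :
    P ((partialDeriv i)^[m] f) := by
  induction m with
  | zero => exact hf
  | succ m ih => rw [Function.iterate_succ_apply']; exact hP _ _ ih

lemma listDeriv_induction {P : (RSpace n → ℝ) → Prop} (hP : ∀ i f, P f → P (partialDeriv i f))
    (α : Fin n → ℕ) (l : List (Fin n)) {f : RSpace n → ℝ} (hf : P f) : P (listDeriv α l f) := by
  induction l with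
  | nil => exact hf
  | cons j l ih => exact iterate_partialDeriv_induction hP _ _ ih

lemma contDiff_listDeriv (α : Fin n → ℕ) (l : List (Fin n)) {f : RSpace n → ℝ}
    (hf : ContDiff ℝ (∞ : ℕ∞ω) f) : ContDiff ℝ (∞ : ℕ∞ω) (listDeriv α l f) :=
  listDeriv_induction (P := fun f => ContDiff ℝ (∞ : ℕ∞ω) f)
    (fun i _ h => contDiff_partialDeriv i h) α l hf

lemma hasCompactSupport_listDeriv (α : Fin n → ℕ) (l : List (Fin n)) {f : RSpace n → ℝ}
    (hf : HasCompactSupport f) : HasCompactSupport (listDeriv α l f) :=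
  listDeriv_induction (P := fun f => HasCompactSupport f)
    (fun i _ h => hasCompactSupport_partialDeriv i h) α l hf

lemma partialDeriv_iterate_comm (i j : Fin n) (m : ℕ) {f : RSpace n → ℝ}
    (hf : ContDiff ℝ (∞ : ℕ∞ω) f) :
    (partialDeriv j)^[m] (partialDeriv i f) = partialDeriv i ((partialDeriv j)^[m] f) := by
  induction m with
  | zero => rfl
  | succ m ih =>
    rw [Function.iterate_succ_apply', Function.iterate_succ_apply', ih, partialDeriv_comm]
    exact iterate_partialDeriv_induction (P := fun f => ContDiff ℝ (∞ : ℕ∞ω) f)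
      (fun i _ h => contDiff_partialDeriv i h) _ _ hf

lemma listDeriv_add_single_of_notMem (α : Fin n → ℕ) {i : Fin n} {l : List (Fin n)} (hi : i ∉ l)
    (f : RSpace n → ℝ) : listDeriv (α + Pi.single i 1) l f = listDeriv α l f := by
  induction l with
  | nil => rfl
  | cons j l ih =>
    simp only [List.mem_cons, not_or] at hi
    have hj : (α + Pi.single i 1 : Fin n → ℕ) j = α j := by simp [Ne.symm hi.1]
    change (partialDeriv j)^[(α + Pi.single i 1 : Fin n → ℕ) j]
      (listDeriv (α + Pi.single i 1) l f) = (partialDeriv j)^[α j] (listDeriv α l f)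
    rw [hj, ih hi.2]

/-- Partial derivatives of smooth functions commute, so the extra derivative can be moved outside;
`Nodup` ensures that it is counted only once. -/
lemma listDeriv_add_single (α : Fin n → ℕ) {i : Fin n} {l : List (Fin n)} (hi : i ∈ l)
    (hl : l.Nodup) {f : RSpace n → ℝ} (hf : ContDiff ℝ (∞ : ℕ∞ω) f) :
    listDeriv (α + Pi.single i 1) l f = partialDeriv i (listDeriv α l f) := by
  induction l with
  | nil => simp at hi
  | cons j l ih =>
    rw [List.nodup_cons] at hl
    change (partialDeriv j)^[(α + Pi.single i 1 : Fin n → ℕ) j] (listDeriv (α + Pi.single i 1) l f) =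
      partialDeriv i ((partialDeriv j)^[α j] (listDeriv α l f))
    by_cases hj : j = i
    · subst hj
      rw [listDeriv_add_single_of_notMem α hl.1, Pi.add_apply, Pi.single_eq_same,
        Function.iterate_succ_apply']
    · have hj' : (α + Pi.single i 1 : Fin n → ℕ) j = α j := by simp [hj]
      have hil : i ∈ l := (List.mem_cons.1 hi).resolve_left (Ne.symm hj)
      rw [hj', ih hil hl.2, partialDeriv_iterate_comm _ _ _ (contDiff_listDeriv α l hf)]

lemma mixedDeriv_add_single (α : Fin n → ℕ) (i : Fin n) {f : RSpace n → ℝ}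
    (hf : ContDiff ℝ (∞ : ℕ∞ω) f) :
    mixedDeriv (α + Pi.single i 1) f = partialDeriv i (mixedDeriv α f) :=
  listDeriv_add_single α (List.mem_finRange i) (List.nodup_finRange n) hf

lemma mixedDeriv_zero (f : RSpace n → ℝ) : mixedDeriv 0 f = f := by
  have : ∀ l : List (Fin n), listDeriv 0 l f = f := fun l => by
    induction l with
    | nil => rfl
    | cons j l ih => exact ih
  exact this _

lemma partialDeriv_reflect (i : Fin n) (c : ℝ) {f : RSpace n → ℝ}
    (hf : ContDiff ℝ (∞ : ℕ∞ω) f) (x : RSpace n) :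
    partialDeriv i (fun y => c * f (x - y)) = fun y => (-1 * c) * partialDeriv i f (x - y) := by
  ext y
  have h1 : HasFDerivAt f (fderiv ℝ f (x - y)) (x - y) :=
    (hf.differentiable (by simp) _).hasFDerivAt
  have h2 := (h1.comp y ((hasFDerivAt_const x y).sub (hasFDerivAt_id y))).const_mul c
  have h3 : fderiv ℝ (fun y => c * f (x - y)) y = _ := h2.fderiv
  unfold partialDeriv
  rw [h3]
  simp

lemma listDeriv_reflect (α : Fin n → ℕ) (l : List (Fin n)) {f : RSpace n → ℝ}
    (hf : ContDiff ℝ (∞ : ℕ∞ω) f) (x : RSpace n) :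
    listDeriv α l (fun y => f (x - y)) =
      fun y => (-1) ^ (l.map α).sum * listDeriv α l f (x - y) := by
  induction l with
  | nil => simp [listDeriv]
  | cons j l ih =>
    change (partialDeriv j)^[α j] (listDeriv α l _) =
      fun y => _ * (partialDeriv j)^[α j] (listDeriv α l f) (x - y)
    rw [ih, List.map_cons, List.sum_cons]
    generalize α j = m
    induction m with
    | zero => simp
    | succ m ihm =>
      rw [Function.iterate_succ_apply', ihm, Function.iterate_succ_apply', partialDeriv_reflect]
      · ext y; ring
      · exact iterate_partialDeriv_induction (P := fun f => ContDiff ℝ (∞ : ℕ∞ω) f)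
          (fun i _ h => contDiff_partialDeriv i h) _ _ (contDiff_listDeriv α l hf)

lemma mixedDeriv_reflect (α : Fin n → ℕ) {f : RSpace n → ℝ} (hf : ContDiff ℝ (∞ : ℕ∞ω) f)
    (x : RSpace n) :
    mixedDeriv α (fun y => f (x - y)) = fun y => (-1) ^ (∑ i, α i) * mixedDeriv α f (x - y) := by
  have h := listDeriv_reflect α (List.finRange n) hf x
  rw [← List.ofFn_eq_map, List.sum_ofFn] at h
  exact h

/-! ### Mollification of weak derivatives -/

lemma conv_eq_swap (φ g : RSpace n → ℝ) (x : RSpace n) :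
    conv φ g x = ∫ y, φ (x - y) * g y :=
  convolution_eq_swap _

lemma hasCompactSupport_reflect {φ : RSpace n → ℝ} (hφ : HasCompactSupport φ) (x : RSpace n) :
    HasCompactSupport fun y => φ (x - y) :=
  hφ.comp_homeomorph (Homeomorph.subLeft x)

/-- Test the weak derivative against y ↦ φ(x - y). The sign from the reflection cancels the sign
from integration by parts. -/
lemma IsWeakDeriv.conv_eq {α : Fin n → ℕ} {u g : RSpace n → ℝ} (h : IsWeakDeriv α u g)
    {φ : RSpace n → ℝ} (hφ : ContDiff ℝ (∞ : ℕ∞ω) φ) (hφc : HasCompactSupport φ) :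
    conv φ g = conv (mixedDeriv α φ) u := by
  ext x
  have key := h.integral_eq (fun y => φ (x - y)) (hφ.comp (contDiff_const.sub contDiff_id))
    (hasCompactSupport_reflect hφc x)
  rw [mixedDeriv_reflect α hφ] at key
  rw [conv_eq_swap, conv_eq_swap]
  have hne : ((-1 : ℝ)) ^ (∑ i, α i) ≠ 0 := pow_ne_zero _ (by norm_num)
  refine mul_left_cancel₀ hne ?_
  simp only [mul_comm (φ _)]
  rw [← key, ← integral_const_mul]
  congr 1
  ext y
  ring

lemma hasFDerivAt_conv {φ u : RSpace n → ℝ} (hφ : ContDiff ℝ (∞ : ℕ∞ω) φ)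
    (hφc : HasCompactSupport φ) (hu : LocallyIntegrable u) (x : RSpace n) :
    HasFDerivAt (conv φ u) ((fderiv ℝ φ ⋆[(ContinuousLinearMap.lsmul ℝ ℝ).precompL (RSpace n),
      volume] u) x) x :=
  hφc.hasFDerivAt_convolution_left _ (hφ.of_le (by simp)) hu x

lemma partialDeriv_conv {φ u : RSpace n → ℝ} (hφ : ContDiff ℝ (∞ : ℕ∞ω) φ)
    (hφc : HasCompactSupport φ) (hu : LocallyIntegrable u) (i : Fin n) :
    partialDeriv i (conv φ u) = conv (partialDeriv i φ) u := by
  ext x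
  unfold partialDeriv
  rw [(hasFDerivAt_conv hφ hφc hu x).fderiv, conv_apply, convolution_def,
    ContinuousLinearMap.integral_apply]
  · simp [ContinuousLinearMap.precompL_apply]
  · exact (hφc.fderiv ℝ).convolutionExists_left _ (hφ.continuous_fderiv (by simp)) hu x

lemma contDiff_conv {φ u : RSpace n → ℝ} (hφ : ContDiff ℝ (∞ : ℕ∞ω) φ)
    (hφc : HasCompactSupport φ) (hu : LocallyIntegrable u) :
    ContDiff ℝ (∞ : ℕ∞ω) (conv φ u) :=
  hφc.contDiff_convolution_left (n := ⊤) _ hφ hu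

lemma hasContPartial_of_contDiff (i : Fin n) {f : RSpace n → ℝ} (hf : ContDiff ℝ (∞ : ℕ∞ω) f) :
    HasContPartial i f (partialDeriv i f) where
  continuous := hf.continuous
  continuous_deriv := (contDiff_partialDeriv i hf).continuous
  hasDerivAt z τ := by
    have h1 := (hf.differentiable (by simp) (z + τ • EuclideanSpace.single i 1)).hasFDerivAt
    have h2 : HasDerivAt (fun τ : ℝ => z + τ • (EuclideanSpace.single i 1 : RSpace n))
        (EuclideanSpace.single i 1) τ := by
      simpa using ((hasDerivAt_id τ).smul_const (EuclideanSpace.single i (1 : ℝ))).const_add z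
    exact h1.comp_hasDerivAt τ h2

lemma IsWeakDeriv.partialDeriv_conv {α : Fin n → ℕ} {i : Fin n} {u g g' : RSpace n → ℝ}
    (h : IsWeakDeriv α u g) (h' : IsWeakDeriv (α + Pi.single i 1) u g')
    {φ : RSpace n → ℝ} (hφ : ContDiff ℝ (∞ : ℕ∞ω) φ) (hφc : HasCompactSupport φ) :
    partialDeriv i (conv φ g) = conv φ g' := by
  rw [h.conv_eq hφ hφc, h'.conv_eq hφ hφc, mixedDeriv_add_single α i hφ]
  exact DominatingMixed.partialDeriv_conv (contDiff_listDeriv _ _ hφ)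
    (hasCompactSupport_listDeriv _ _ hφc) h.locallyIntegrable i

lemma IsWeakDeriv.hasContPartial {α : Fin n → ℕ} {i : Fin n} {u g g' : RSpace n → ℝ}
    (h : IsWeakDeriv α u g) (h' : IsWeakDeriv (α + Pi.single i 1) u g')
    {φ : RSpace n → ℝ} (hφ : ContDiff ℝ (∞ : ℕ∞ω) φ) (hφc : HasCompactSupport φ) :
    HasContPartial i (conv φ g) (conv φ g') := by
  rw [← h.partialDeriv_conv h' hφ hφc]
  exact hasContPartial_of_contDiff i (contDiff_conv hφ hφc h.locallyIntegrable_deriv)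

lemma IsWeakDeriv.ae_eq {α : Fin n → ℕ} {u g g' : RSpace n → ℝ}
    (h : IsWeakDeriv α u g) (h' : IsWeakDeriv α u g') : g =ᵐ[volume] g' := by
  refine ae_eq_of_integral_contDiff_smul_eq h.locallyIntegrable_deriv h'.locallyIntegrable_deriv
    fun φ hφ hφc => ?_
  have h1 := (h.integral_eq φ hφ hφc).symm.trans (h'.integral_eq φ hφ hφc)
  have h2 := mul_left_cancel₀ (pow_ne_zero _ (by norm_num)) h1
  simpa only [smul_eq_mul, mul_comm] using h2

lemma IsWeakDeriv.congr {α : Fin n → ℕ} {u g g' : RSpace n → ℝ}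
    (h : IsWeakDeriv α u g) (hg : g =ᵐ[volume] g') : IsWeakDeriv α u g' where
  locallyIntegrable := h.locallyIntegrable
  locallyIntegrable_deriv := h.locallyIntegrable_deriv.congr hg
  integral_eq φ hφ hφc := by
    rw [h.integral_eq φ hφ hφc]
    congr 1
    refine integral_congr_ae ?_
    filter_upwards [hg] with x hx
    rw [hx]

lemma IsWeakDeriv.weakDerivNorm_eq {α : Fin n → ℕ} {u g : RSpace n → ℝ}
    (h : IsWeakDeriv α u g) (p : ℝ≥0∞) : weakDerivNorm α p u = eLpNorm g p volume := by
  refine le_antisymm (iInf₂_le g h) (le_iInf₂ fun g' h' => ?_)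
  rw [eLpNorm_congr_ae (h.ae_eq h')]

lemma exists_isWeakDeriv {α : Fin n → ℕ} {p : ℝ≥0∞} {u : RSpace n → ℝ}
    (h : weakDerivNorm α p u < ⊤) : ∃ g, IsWeakDeriv α u g ∧ Measurable g := by
  obtain ⟨g, hg⟩ := iInf_lt_iff.1 h
  obtain ⟨hw, -⟩ := iInf_lt_iff.1 hg
  have hm := hw.locallyIntegrable_deriv.aestronglyMeasurable
  exact ⟨hm.mk g, hw.congr hm.ae_eq_mk, hm.stronglyMeasurable_mk.measurable⟩

lemma IsWeakDeriv.ae_eq_of_zero {u g : RSpace n → ℝ} (h : IsWeakDeriv 0 u g) :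
    g =ᵐ[volume] u := by
  refine h.ae_eq ⟨h.locallyIntegrable, h.locallyIntegrable, fun φ _ _ => ?_⟩
  simp [mixedDeriv_zero]

/-! ### Mollifiers -/

/-- A sequence of bump functions concentrating at the origin. -/
def bump (n j : ℕ) : ContDiffBump (0 : RSpace n) where
  rIn := 1 / ((j : ℝ) + 1)
  rOut := 2 / ((j : ℝ) + 1)
  rIn_pos := by positivity
  rIn_lt_rOut := by gcongr; norm_num

/-- The normalized bump functions. -/
def mollifier (n j : ℕ) : RSpace n → ℝ := (bump n j).normed volume

lemma tendsto_bump_rOut (n : ℕ) : Tendsto (fun j => (bump n j).rOut) atTop (𝓝 0) := by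
  have h := (tendsto_one_div_add_atTop_nhds_zero_nat (𝕜 := ℝ)).const_mul 2
  simpa [bump, div_eq_mul_inv] using h

lemma contDiff_mollifier (n j : ℕ) : ContDiff ℝ (∞ : ℕ∞ω) (mollifier n j) :=
  (bump n j).contDiff_normed

lemma hasCompactSupport_mollifier (n j : ℕ) : HasCompactSupport (mollifier n j) :=
  (bump n j).hasCompactSupport_normed

/-- Convergence jointly in the index and the point is what yields the locally uniform convergence
needed to differentiate the limit. -/
lemma tendsto_conv_mollifier_prod {g : RSpace n → ℝ} (hg : Continuous g) (x : RSpace n) :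
    Tendsto (fun q : ℕ × RSpace n => conv (mollifier n q.1) g q.2) (atTop ×ˢ 𝓝 x)
      (𝓝 (g x)) := by
  have h := ContDiffBump.convolution_tendsto_right (μ := volume)
    (φ := fun q : ℕ × RSpace n => bump n q.1) (g := fun _ => g) (k := Prod.snd) (x₀ := x)
    (z₀ := g x) (l := atTop ×ˢ 𝓝 x) ((tendsto_bump_rOut n).comp tendsto_fst)
    (.of_forall fun _ => hg.aestronglyMeasurable) ((hg.tendsto x).comp tendsto_snd) tendsto_snd
  exact h

lemma tendsto_conv_mollifier {g : RSpace n → ℝ} (hg : Continuous g) (x : RSpace n) :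
    Tendsto (fun j => conv (mollifier n j) g x) atTop (𝓝 (g x)) :=
  ContDiffBump.convolution_tendsto_right_of_continuous (tendsto_bump_rOut n) hg x

lemma ae_tendsto_conv_mollifier {g : RSpace n → ℝ} (hg : LocallyIntegrable g) :
    ∀ᵐ x, Tendsto (fun j => conv (mollifier n j) g x) atTop (𝓝 (g x)) := by
  -- The constant 2 is the fixed ratio of outer to inner radius in `bump`.
  refine ContDiffBump.ae_convolution_tendsto_right_of_locallyIntegrable (K := 2)
    (tendsto_bump_rOut n) (.of_forall fun j => ?_) hg
  simp only [bump]
  rw [mul_one_div]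

/-! ### The continuous representative -/

/-- The multi-index of a set of directions. -/
def indicatorIndex (s : Finset (Fin n)) : Fin n → ℕ := fun i => if i ∈ s then 1 else 0

lemma indicatorIndex_empty : indicatorIndex (∅ : Finset (Fin n)) = 0 := by
  ext; simp [indicatorIndex]

lemma indicatorIndex_insert {s : Finset (Fin n)} {i : Fin n} (hi : i ∉ s) :
    indicatorIndex (insert i s) = indicatorIndex s + Pi.single i 1 := by
  ext j
  by_cases hj : j = i
  · subst hj; simp [indicatorIndex, hi]
  · simp [indicatorIndex, hj]

lemma indicatorIndex_le_one (s : Finset (Fin n)) : indicatorIndex s ≤ 1 := by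
  intro j
  simp only [indicatorIndex, Pi.one_apply]
  split_ifs <;> simp

/-- A choice of the weak derivatives of `u` with multi-indices below `K`. -/
structure IsDerivFamily (K : Fin n → ℕ) (u : RSpace n → ℝ)
    (G : (Fin n → ℕ) → RSpace n → ℝ) : Prop where
  weak : ∀ α ≤ K, IsWeakDeriv α u (G α)
  measurable : ∀ α ≤ K, Measurable (G α)

/-- The alternating sum of box averages of the derivatives in directions from `S`. -/
def boxRep (G : (Fin n → ℕ) → RSpace n → ℝ) (S : Finset (Fin n)) (ℓ : Fin n → ℝ)
    (α : Fin n → ℕ) (x : RSpace n) : ℝ :=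
  ∑ s ∈ S.powerset, (-1) ^ s.card * boxAverage (cubeWeight s) ℓ (G (α + indicatorIndex s)) x

/-- The continuous representative of the derivative with multi-index `α`. -/
def rep (G : (Fin n → ℕ) → RSpace n → ℝ) (α : Fin n → ℕ) : RSpace n → ℝ :=
  boxRep G Finset.univ (fun _ => 1) α

/-- The coordinate functionals. -/
abbrev coord (i : Fin n) : RSpace n →L[ℝ] ℝ := EuclideanSpace.proj i

lemma sum_coord_smul_single (v : RSpace n) :
    ∑ i, v i • (EuclideanSpace.single i 1 : RSpace n) = v := by
  ext j
  simp [Finset.sum_apply, Pi.single_apply]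

lemma fderiv_eq_sum_partialDeriv (f : RSpace n → ℝ) (x : RSpace n) :
    fderiv ℝ f x = ∑ i, partialDeriv i f x • coord i := by
  ext v
  conv_lhs => rw [← sum_coord_smul_single v]
  simp [partialDeriv, mul_comm]

/-- The candidate for the derivative of `rep G α`. -/
def repFDeriv (G : (Fin n → ℕ) → RSpace n → ℝ) (α : Fin n → ℕ) (x : RSpace n) :
    RSpace n →L[ℝ] ℝ :=
  ∑ i, rep G (α + Pi.single i 1) x • coord i

/-! ### Continuity, increments and differentiability of the representative -/

namespace IsDerivFamily

variable {K : Fin n → ℕ} {u : RSpace n → ℝ} {G : (Fin n → ℕ) → RSpace n → ℝ}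

lemma locallyIntegrable (h : IsDerivFamily K u G) {α : Fin n → ℕ} (hα : α ≤ K) :
    LocallyIntegrable (G α) :=
  (h.weak α hα).locallyIntegrable_deriv

lemma continuous_boxRep (h : IsDerivFamily K u G) {S : Finset (Fin n)} {ℓ : Fin n → ℝ}
    (hℓ : ∀ i, ℓ i ≠ 0) {α : Fin n → ℕ} (hα : ∀ s ⊆ S, α + indicatorIndex s ≤ K) :
    Continuous (boxRep G S ℓ α) := by
  unfold boxRep
  refine continuous_finsetSum _ fun s hs => continuous_const.mul ?_
  exact continuous_boxAverage s hℓ (h.locallyIntegrable (hα s (Finset.mem_powerset.1 hs)))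

lemma conv_boxRep (h : IsDerivFamily K u G) {S : Finset (Fin n)} {ℓ : Fin n → ℝ}
    (hℓ : ∀ i, ℓ i ≠ 0) {α : Fin n → ℕ} (hα : ∀ s ⊆ S, α + indicatorIndex s ≤ K)
    {φ : RSpace n → ℝ} (hφ : Continuous φ) (hφc : HasCompactSupport φ) (x : RSpace n) :
    conv φ (boxRep G S ℓ α) x = boxRep (fun β => conv φ (G β)) S ℓ α x := by
  have hint : ∀ s ∈ S.powerset, Integrable fun y =>
      φ y * ((-1) ^ s.card * boxAverage (cubeWeight s) ℓ (G (α + indicatorIndex s)) (x - y)) := by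
    intro s hs
    have hc := continuous_boxAverage s hℓ
      (h.locallyIntegrable (hα s (Finset.mem_powerset.1 hs)))
    exact Continuous.integrable_of_hasCompactSupport (by fun_prop) hφc.mul_right
  simp only [conv_apply, boxRep, Finset.mul_sum]
  rw [integral_finsetSum _ hint]
  refine Finset.sum_congr rfl fun s hs => ?_
  have hsα := hα s (Finset.mem_powerset.1 hs)
  rw [boxAverage_conv s ℓ hφ hφc (h.locallyIntegrable hsα) (h.measurable _ hsα), conv_apply,
    ← integral_const_mul]
  congr 1
  ext y
  ring

lemma add_indicatorIndex_le {α : Fin n → ℕ} (hα : α + 1 ≤ K) (s : Finset (Fin n)) :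
    α + indicatorIndex s ≤ K :=
  (add_le_add_right (indicatorIndex_le_one s) α).trans hα

/-- Since s avoids i, the total added to α is still at most 1 in each variable. Increments therefore
require no more derivatives than values do. -/
lemma add_single_add_indicatorIndex_le {α : Fin n → ℕ} (hα : α + 1 ≤ K) {i : Fin n}
    {s : Finset (Fin n)} (hs : s ⊆ Finset.univ.erase i) :
    α + Pi.single i 1 + indicatorIndex s ≤ K := by
  have hi : i ∉ s := fun h => by simpa using hs h
  rw [add_assoc, add_comm (Pi.single i 1), ← indicatorIndex_insert hi]
  exact add_indicatorIndex_le hα _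

lemma continuous_rep (h : IsDerivFamily K u G) {α : Fin n → ℕ} (hα : α + 1 ≤ K) :
    Continuous (rep G α) :=
  h.continuous_boxRep (by simp) fun s _ => add_indicatorIndex_le hα s

lemma boxAverage_conv_eq (h : IsDerivFamily K u G) {S : Finset (Fin n)} {ℓ : Fin n → ℝ}
    (hℓ : ∀ i ∈ S, ℓ i = 0) {α : Fin n → ℕ} (hα : ∀ s ⊆ S, α + indicatorIndex s ≤ K)
    {φ : RSpace n → ℝ} (hφ : ContDiff ℝ (∞ : ℕ∞ω) φ) (hφc : HasCompactSupport φ)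
    (x : RSpace n) :
    boxAverage (cubeWeight ∅) ℓ (conv φ (G α)) x =
      boxRep (fun β => conv φ (G β)) S (fun j => if j ∈ S then 1 else ℓ j) α x := by
  have hw := boxAverage_expansion (w := fun s => conv φ (G (α + indicatorIndex s))) S
    (fun s hs i hiS hi => ?_) ℓ hℓ x
  · rw [indicatorIndex_empty, add_zero] at hw
    exact hw
  · have h1 := h.weak _ (hα s hs)
    have h2 := h.weak _ (hα (insert i s) (Finset.insert_subset hiS hs))
    rw [indicatorIndex_insert hi, ← add_assoc] at h2
    rw [indicatorIndex_insert hi, ← add_assoc]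
    exact h1.hasContPartial h2 hφ hφc

/-- Mollified weak derivatives are smooth and satisfy the expansion exactly; with all sides zero its
left side is the point value, and on its right side the convolution passes through the averages. -/
lemma conv_rep (h : IsDerivFamily K u G) {α : Fin n → ℕ} (hα : α + 1 ≤ K)
    {φ : RSpace n → ℝ} (hφ : ContDiff ℝ (∞ : ℕ∞ω) φ) (hφc : HasCompactSupport φ) :
    conv φ (rep G α) = conv φ (G α) := by
  ext x
  have h1 := h.boxAverage_conv_eq (S := Finset.univ) (ℓ := 0) (by simp)
    (fun s _ => add_indicatorIndex_le hα s) hφ hφc x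
  rw [boxAverage_zero] at h1
  rw [h1, rep, h.conv_boxRep (by simp) (fun s _ => add_indicatorIndex_le hα s)
    hφ.continuous hφc]
  simp

lemma rep_ae_eq (h : IsDerivFamily K u G) {α : Fin n → ℕ} (hα : α + 1 ≤ K) :
    rep G α =ᵐ[volume] G α := by
  have hαK : α ≤ K := (le_add_of_nonneg_right zero_le_one).trans hα
  filter_upwards [ae_tendsto_conv_mollifier (h.locallyIntegrable hαK)] with x hx
  refine tendsto_nhds_unique (tendsto_conv_mollifier (h.continuous_rep hα) x) ?_
  simpa only [h.conv_rep hα (contDiff_mollifier n _) (hasCompactSupport_mollifier n _)] using hx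

/-- For mollifications, `boxAverage_single` expresses the increment as a segment average, which is
then expanded in the directions other than i. Both sides are continuous in the point, so the
identity survives removal of the mollifier. -/
lemma rep_sub_rep (h : IsDerivFamily K u G) {α : Fin n → ℕ} (hα : α + 1 ≤ K) (i : Fin n)
    {c : ℝ} (hc : c ≠ 0) (x : RSpace n) :
    rep G α (x + c • EuclideanSpace.single i 1) - rep G α x =
      c * boxRep G (Finset.univ.erase i) (Function.update (fun _ => 1) i c)
        (α + Pi.single i 1) x := by
  have hℓ : ∀ j, Function.update (fun _ : Fin n => (1 : ℝ)) i c j ≠ 0 := by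
    intro j
    by_cases hj : j = i
    · subst hj; simpa using hc
    · simp [hj]
  have hS : ∀ s ⊆ Finset.univ.erase i, α + Pi.single i 1 + indicatorIndex s ≤ K :=
    fun s hs => add_single_add_indicatorIndex_le hα hs
  have hcont := h.continuous_rep hα
  refine tendsto_nhds_unique ((tendsto_conv_mollifier hcont _).sub
    (tendsto_conv_mollifier hcont x)) (((tendsto_conv_mollifier
      (h.continuous_boxRep hℓ hS) x).const_mul c).congr fun j => ?_)
  have hφ := contDiff_mollifier n j
  have hφc := hasCompactSupport_mollifier n j
  have hαK : α ≤ K := (le_add_of_nonneg_right zero_le_one).trans hα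
  have hαi := h.weak (α + Pi.single i 1) (by
    simpa [indicatorIndex_empty] using hS ∅ (Finset.empty_subset _))
  rw [h.conv_rep hα hφ hφc, ← boxAverage_single ((h.weak α hαK).hasContPartial hαi hφ hφc),
    h.boxAverage_conv_eq (S := Finset.univ.erase i) (fun j hj => ?_) hS hφ hφc,
    h.conv_boxRep hℓ hS hφ.continuous hφc]
  · congr 2
    ext j
    by_cases hj : j = i
    · subst hj; simp
    · simp [hj]
  · simp [Finset.ne_of_mem_erase hj]

lemma hasFDerivAt_conv_rep (h : IsDerivFamily K u G) {α : Fin n → ℕ} (hα : α + 1 ≤ K)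
    (hαi : ∀ i, α + Pi.single i 1 + 1 ≤ K) {φ : RSpace n → ℝ}
    (hφ : ContDiff ℝ (∞ : ℕ∞ω) φ) (hφc : HasCompactSupport φ) (y : RSpace n) :
    HasFDerivAt (conv φ (rep G α)) (∑ i, conv φ (rep G (α + Pi.single i 1)) y • coord i) y := by
  have hαK : α ≤ K := (le_add_of_nonneg_right zero_le_one).trans hα
  have hd := (contDiff_conv hφ hφc (h.continuous_rep hα).locallyIntegrable).differentiable
    (by simp) y
  refine hd.hasFDerivAt.congr_fderiv ?_
  rw [fderiv_eq_sum_partialDeriv]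
  refine Finset.sum_congr rfl fun i _ => ?_
  rw [h.conv_rep hα hφ hφc, h.conv_rep (hαi i) hφ hφc,
    (h.weak α hαK).partialDeriv_conv (h.weak _
      ((le_add_of_nonneg_right zero_le_one).trans (hαi i))) hφ hφc]

lemma continuous_repFDeriv (h : IsDerivFamily K u G) {α : Fin n → ℕ}
    (hαi : ∀ i, α + Pi.single i 1 + 1 ≤ K) : Continuous (repFDeriv G α) :=
  continuous_finsetSum _ fun i _ => (h.continuous_rep (hαi i)).smul continuous_const

lemma tendsto_sum_conv_mollifier (h : IsDerivFamily K u G) {α : Fin n → ℕ}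
    (hαi : ∀ i, α + Pi.single i 1 + 1 ≤ K) (x : RSpace n) :
    Tendsto (fun q : ℕ × RSpace n =>
      ∑ i, conv (mollifier n q.1) (rep G (α + Pi.single i 1)) q.2 • coord i)
      (atTop ×ˢ 𝓝 x) (𝓝 (repFDeriv G α x)) :=
  tendsto_finsetSum _ fun i _ =>
    (tendsto_conv_mollifier_prod (h.continuous_rep (hαi i)) x).smul_const _

/-- Mollifications of `rep G α` converge pointwise, and their derivatives, being mollifications of
the continuous functions `rep G (α + Pi.single i 1)`, converge uniformly near x. -/
lemma hasFDerivAt_rep (h : IsDerivFamily K u G) {α : Fin n → ℕ} (hα : α + 1 ≤ K)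
    (hαi : ∀ i, α + Pi.single i 1 + 1 ≤ K) (x : RSpace n) :
    HasFDerivAt (rep G α) (repFDeriv G α x) x := by
  have hU : TendstoUniformlyOnFilter
      (fun j y => ∑ i, conv (mollifier n j) (rep G (α + Pi.single i 1)) y • coord i)
      (repFDeriv G α) atTop (𝓝 x) := by
    rw [tendstoUniformlyOnFilter_iff_tendsto]
    refine Tendsto.mono_right ?_ (nhds_le_uniformity (repFDeriv G α x))
    rw [nhds_prod_eq]
    exact Tendsto.prodMk (((h.continuous_repFDeriv hαi).tendsto x).comp tendsto_snd)
      (h.tendsto_sum_conv_mollifier hαi x)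
  refine hasFDerivAt_of_tendstoUniformlyOnFilter hU
    (f := fun j => conv (mollifier n j) (rep G α)) (.of_forall fun q => ?_)
    (.of_forall fun y => tendsto_conv_mollifier (h.continuous_rep hα) y)
  exact h.hasFDerivAt_conv_rep hα hαi (contDiff_mollifier n q.1)
    (hasCompactSupport_mollifier n q.1) q.2

end IsDerivFamily

/-! ### Classical derivatives of the representative -/

lemma sum_add_single (α : Fin n → ℕ) (i : Fin n) :
    ∑ j, (α + Pi.single i 1 : Fin n → ℕ) j = ∑ j, α j + 1 := by
  simp [Finset.sum_add_distrib]

/-- The passage from isotropic to mixed order: each component is at most the total order, so one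
further derivative in every variable is still available. -/
lemma add_one_le_of_sum_lt {α : Fin n → ℕ} {k : ℕ} (hα : ∑ i, α i + 1 ≤ k) :
    α + 1 ≤ fun _ => k := fun i =>
  (Nat.add_le_add_right (Finset.single_le_sum (f := α) (fun _ _ => Nat.zero_le _)
    (Finset.mem_univ i)) 1).trans hα

/-- The multi-index counting the occurrences of each direction. -/
def countIndex {j : ℕ} (I : Fin j → Fin n) : Fin n → ℕ := ∑ l, Pi.single (I l) 1

lemma sum_countIndex {j : ℕ} (I : Fin j → Fin n) : ∑ i, countIndex I i = j := by
  simp only [countIndex, Finset.sum_apply]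
  rw [Finset.sum_comm]
  simp

lemma countIndex_succ {j : ℕ} (I : Fin (j + 1) → Fin n) :
    countIndex I = countIndex (Fin.tail I) + Pi.single (I 0) 1 := by
  rw [countIndex, Fin.sum_univ_succ, add_comm]
  rfl

lemma repFDeriv_single (G : (Fin n → ℕ) → RSpace n → ℝ) (α : Fin n → ℕ) (x : RSpace n)
    (i : Fin n) : repFDeriv G α x (EuclideanSpace.single i 1) = rep G (α + Pi.single i 1) x := by
  simp [repFDeriv]

namespace IsDerivFamily

variable {k : ℕ} {u : RSpace n → ℝ} {G : (Fin n → ℕ) → RSpace n → ℝ}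

lemma hasFDerivAt_rep_of_sum (h : IsDerivFamily (fun _ => k) u G) {α : Fin n → ℕ}
    (hα : ∑ i, α i + 1 + 1 ≤ k) (x : RSpace n) :
    HasFDerivAt (rep G α) (repFDeriv G α x) x :=
  h.hasFDerivAt_rep (add_one_le_of_sum_lt (by omega))
    (fun i => add_one_le_of_sum_lt (by rw [sum_add_single]; exact hα)) x

lemma contDiff_rep (h : IsDerivFamily (fun _ => k) u G) (m : ℕ) {α : Fin n → ℕ}
    (hα : ∑ i, α i + m + 1 ≤ k) : ContDiff ℝ m (rep G α) := by
  induction m generalizing α with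
  | zero => exact contDiff_zero.2 (h.continuous_rep (add_one_le_of_sum_lt (by omega)))
  | succ m ih =>
    rw [Nat.cast_add, Nat.cast_one, contDiff_succ_iff_hasFDerivAt]
    refine ⟨repFDeriv G α, ?_, fun x => h.hasFDerivAt_rep_of_sum (by omega) x⟩
    exact ContDiff.sum fun i _ =>
      (ih (by rw [sum_add_single]; omega)).smul contDiff_const

/-- The induction peels off the direction `I 0`. The remaining entry is already a representative,
and uniqueness of the derivative identifies its partial derivative with the next one. -/
lemma iteratedFDeriv_rep (h : IsDerivFamily (fun _ => k) u G) (j : ℕ) (hj : j + 1 ≤ k)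
    (I : Fin j → Fin n) (x : RSpace n) :
    iteratedFDeriv ℝ j (rep G 0) x (fun l => EuclideanSpace.single (I l) 1) =
      rep G (countIndex I) x := by
  induction j generalizing x with
  | zero => simp [countIndex]
  | succ j ih =>
    have hsm : ContDiff ℝ (j + 1 : ℕ) (rep G 0) := h.contDiff_rep _ (by simpa using hj)
    have hd : DifferentiableAt ℝ (iteratedFDeriv ℝ j (rep G 0)) x :=
      hsm.differentiable_iteratedFDeriv (by exact_mod_cast Nat.lt_succ_self j) x
    rw [iteratedFDeriv_succ_apply_left]
    have htail : Fin.tail (fun l => (EuclideanSpace.single (I l) 1 : RSpace n)) =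
        fun l => EuclideanSpace.single (Fin.tail I l) 1 := rfl
    rw [htail]
    have hfun : (fun y => iteratedFDeriv ℝ j (rep G 0) y
        fun l => EuclideanSpace.single (Fin.tail I l) 1) = rep G (countIndex (Fin.tail I)) := by
      ext y
      exact ih (by omega) (Fin.tail I) y
    have h1 := hd.hasFDerivAt.continuousMultilinear_apply_const
      (fun l => EuclideanSpace.single (Fin.tail I l) 1)
    rw [hfun] at h1
    have h2 := h1.unique (h.hasFDerivAt_rep_of_sum (by rw [sum_countIndex]; omega) x)
    have h3 := DFunLike.congr_fun h2 (EuclideanSpace.single (I 0) 1)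
    rw [repFDeriv_single, ← countIndex_succ] at h3
    exact h3

end IsDerivFamily

/-! ### Norm estimates -/

lemma enorm_boxRep_le {K : Fin n → ℕ} {u : RSpace n → ℝ} {G : (Fin n → ℕ) → RSpace n → ℝ}
    (h : IsDerivFamily K u G) {p : ℝ≥0∞} (hp : 1 ≤ p) {S : Finset (Fin n)} {ℓ : Fin n → ℝ}
    (hℓ : ∀ i, ℓ i ≠ 0) {α : Fin n → ℕ} (hα : ∀ s ⊆ S, α + indicatorIndex s ≤ K)
    (x : RSpace n) :
    ‖boxRep G S ℓ α x‖ₑ ≤ 2 ^ n * (ENNReal.ofReal |∏ i, ℓ i|⁻¹ ^ (1 / p).toReal *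
      ∑ β ∈ Finset.Iic K, eLpNorm (G β) p volume) := by
  have hterm : ∀ s ∈ S.powerset,
      ‖(-1) ^ s.card * boxAverage (cubeWeight s) ℓ (G (α + indicatorIndex s)) x‖ₑ ≤
        ENNReal.ofReal |∏ i, ℓ i|⁻¹ ^ (1 / p).toReal *
          ∑ β ∈ Finset.Iic K, eLpNorm (G β) p volume := by
    intro s hs
    have hsα := hα s (Finset.mem_powerset.1 hs)
    rw [enorm_mul, enorm_pow, enorm_neg, enorm_one, one_pow, one_mul]
    refine (enorm_boxAverage_le s hℓ (h.measurable _ hsα).aestronglyMeasurable hp x).trans ?_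
    gcongr
    exact Finset.single_le_sum (f := fun β => eLpNorm (G β) p volume) (fun _ _ => zero_le)
      (Finset.mem_Iic.2 hsα)
  -- The factor 2 ^ n bounds the number of subsets of S.
  refine (enorm_sum_le _ _).trans ((Finset.sum_le_card_nsmul _ _ _ hterm).trans ?_)
  rw [nsmul_eq_mul, Finset.card_powerset]
  gcongr
  push_cast
  gcongr
  · norm_num
  · simpa using Finset.card_le_univ S

/-- The factor |c| from the segment meets |c|^(-1/p) from a box of volume |c|. The truncated
subtraction is a true one because p⁻¹ ≤ 1, and p = ∞ gives exponent 1. -/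
lemma ofReal_mul_inv_rpow {p : ℝ≥0∞} (hp : 1 ≤ p) {c : ℝ} (hc : c ≠ 0) :
    ‖c‖ₑ * ENNReal.ofReal |c|⁻¹ ^ (1 / p).toReal = ‖c‖ₑ ^ ((1 - p⁻¹.toNNReal : ℝ≥0) : ℝ) := by
  have hp1 : p⁻¹ ≤ 1 := ENNReal.inv_le_one.2 hp
  have hγ : ((1 - p⁻¹.toNNReal : ℝ≥0) : ℝ) = 1 - (1 / p).toReal := by
    rw [NNReal.coe_sub, one_div]
    · rfl
    · exact_mod_cast ENNReal.toNNReal_mono ENNReal.one_ne_top hp1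
  rw [hγ, ENNReal.rpow_sub _ _ (by simpa using hc) (by simp), ENNReal.rpow_one,
    ENNReal.ofReal_inv_of_pos (abs_pos.2 hc), ENNReal.inv_rpow, ← Real.enorm_eq_ofReal_abs]
  rfl

section Bounds

variable {K : Fin n → ℕ} {u : RSpace n → ℝ} {G : (Fin n → ℕ) → RSpace n → ℝ}

lemma enorm_rep_le (h : IsDerivFamily K u G) {p : ℝ≥0∞} (hp : 1 ≤ p) {α : Fin n → ℕ}
    (hα : α + 1 ≤ K) (x : RSpace n) :
    ‖rep G α x‖ₑ ≤ 2 ^ n * ∑ β ∈ Finset.Iic K, eLpNorm (G β) p volume := by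
  have := enorm_boxRep_le h hp (ℓ := fun _ => 1) (by simp)
    (fun s (_ : s ⊆ Finset.univ) => IsDerivFamily.add_indicatorIndex_le hα s) x
  simpa [rep] using this

lemma enorm_rep_sub_rep_single_le (h : IsDerivFamily K u G) {p : ℝ≥0∞} (hp : 1 ≤ p)
    {α : Fin n → ℕ} (hα : α + 1 ≤ K) (i : Fin n) (c : ℝ) (x : RSpace n) :
    ‖rep G α (x + c • EuclideanSpace.single i 1) - rep G α x‖ₑ ≤
      2 ^ n * (∑ β ∈ Finset.Iic K, eLpNorm (G β) p volume) *
        ‖c‖ₑ ^ ((1 - p⁻¹.toNNReal : ℝ≥0) : ℝ) := by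
  -- For c = 0 the box degenerates, but the increment is zero.
  rcases eq_or_ne c 0 with rfl | hc
  · simp
  have hℓ : ∀ j, Function.update (fun _ : Fin n => (1 : ℝ)) i c j ≠ 0 := by
    intro j
    by_cases hj : j = i
    · subst hj; simpa using hc
    · simp [hj]
  have hb := enorm_boxRep_le h hp hℓ
    (fun s hs => IsDerivFamily.add_single_add_indicatorIndex_le (i := i) hα hs) x
  have hprod : ∏ j, Function.update (fun _ : Fin n => (1 : ℝ)) i c j = c := by
    rw [Finset.prod_update_of_mem (Finset.mem_univ i)]
    simp
  rw [hprod] at hb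
  rw [h.rep_sub_rep hα i hc, enorm_mul, ← ofReal_mul_inv_rpow hp hc]
  refine (mul_le_mul_right hb _).trans (le_of_eq ?_)
  ring

lemma enorm_apply_le (x : RSpace n) (i : Fin n) : ‖x i‖ₑ ≤ ‖x‖ₑ := by
  rw [enorm_le_iff_norm_le]
  exact PiLp.norm_apply_le x i

/-- Move from y to x one coordinate at a time. Each of the n steps has length at most |x - y|. -/
lemma enorm_rep_sub_rep_le (h : IsDerivFamily K u G) {p : ℝ≥0∞} (hp : 1 ≤ p)
    {α : Fin n → ℕ} (hα : α + 1 ≤ K) (x y : RSpace n) :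
    ‖rep G α x - rep G α y‖ₑ ≤
      n * (2 ^ n * (∑ β ∈ Finset.Iic K, eLpNorm (G β) p volume)) *
        edist x y ^ ((1 - p⁻¹.toNNReal : ℝ≥0) : ℝ) := by
  set M := 2 ^ n * (∑ β ∈ Finset.Iic K, eLpNorm (G β) p volume)
  set γ : ℝ := ((1 - p⁻¹.toNNReal : ℝ≥0) : ℝ)
  have key : ∀ S : Finset (Fin n),
      ‖rep G α (y + ∑ i ∈ S, (x - y) i • EuclideanSpace.single i 1) - rep G α y‖ₑ ≤
        S.card * (M * edist x y ^ γ) := by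
    intro S
    induction S using Finset.induction_on with
    | empty => simp
    | insert i S hi ih =>
      rw [Finset.sum_insert hi, add_comm (_ • _), ← add_assoc, Finset.card_insert_of_notMem hi,
        ← sub_add_sub_cancel]
      refine (enorm_add_le _ _).trans ((add_le_add
        (enorm_rep_sub_rep_single_le h hp hα i _ _) ih).trans ?_)
      rw [Nat.cast_succ, add_mul, one_mul, add_comm]
      gcongr
      rw [edist_eq_enorm_sub]
      exact enorm_apply_le _ i
  have := key Finset.univ
  rw [sum_coord_smul_single, add_sub_cancel, Finset.card_univ, Fintype.card_fin,
    ← mul_assoc] at this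
  exact this

end Bounds

lemma enorm_le_sum_enorm_apply {ι : Type*} [Fintype ι] (v : EuclideanSpace ℝ ι) :
    ‖v‖ₑ ≤ ∑ i, ‖v i‖ₑ := by
  classical
  have hv : ∑ i, v i • (EuclideanSpace.single i 1 : EuclideanSpace ℝ ι) = v := by
    ext j
    simp [Finset.sum_apply, Pi.single_apply]
  conv_lhs => rw [← hv]
  refine (enorm_sum_le _ _).trans (Finset.sum_le_sum fun i _ => ?_)
  rw [enorm_smul]
  have : ‖(EuclideanSpace.single i 1 : EuclideanSpace ℝ ι)‖ₑ = 1 := by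
    rw [← ofReal_norm]; simp
  rw [this, mul_one]

/-- The Frobenius norm is at most the sum of the absolute values of the entries. There are n ^ j
entries of order j, each a representative controlled by `enorm_rep_le` and `enorm_rep_sub_rep_le`.
-/
lemma IsDerivFamily.holderNorm_rep_le {k : ℕ} (hk : 1 ≤ k) {u : RSpace n → ℝ}
    {G : (Fin n → ℕ) → RSpace n → ℝ} (h : IsDerivFamily (fun _ => k) u G) {p : ℝ≥0∞}
    (hp : 1 ≤ p) {M : ℝ≥0}
    (hM : ∑ β ∈ Finset.Iic (fun _ : Fin n => k), eLpNorm (G β) p volume = M) :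
    holderNorm (k - 1) (1 - p⁻¹.toNNReal) (rep G 0) ≤
      ((∑ j ∈ Finset.range (k - 1 + 1),
        ((n : ℝ≥0) ^ j * 2 ^ n + (n : ℝ≥0) ^ j * (n * 2 ^ n)) : ℝ≥0) : ℝ≥0∞) * M := by
  rw [holderNorm, ENNReal.ofNNReal_finsetSum, Finset.sum_mul]
  refine Finset.sum_le_sum fun j hj => ?_
  have hj : j + 1 ≤ k := by have := Finset.mem_range.1 hj; omega
  have happly : ∀ (x : RSpace n) (I : Fin j → Fin n),
      derivTensor j (rep G 0) x I = rep G (countIndex I) x :=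
    fun x I => h.iteratedFDeriv_rep j hj I x
  have hidx : ∀ I : Fin j → Fin n, countIndex I + 1 ≤ fun _ => k :=
    fun I => add_one_le_of_sum_lt (by rw [sum_countIndex]; exact hj)
  have hsum : ∀ a : ℝ≥0∞, ∑ _I : Fin j → Fin n, a = n ^ j * a := by
    intro a
    simp
  rw [ENNReal.coe_add, add_mul]
  refine add_le_add (iSup_le fun x => ?_) ?_
  · refine (enorm_le_sum_enorm_apply _).trans ((Finset.sum_le_sum fun I _ => ?_).trans
      (hsum (2 ^ n * M)).le |>.trans (le_of_eq ?_))
    · rw [happly, ← hM]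
      exact enorm_rep_le h hp (hidx I) x
    · push_cast; ring
  · have hH : HolderWith ((n : ℝ≥0) ^ j * (n * 2 ^ n) * M) (1 - p⁻¹.toNNReal)
        (derivTensor j (rep G 0)) := by
      intro x y
      rw [edist_eq_enorm_sub]
      refine (enorm_le_sum_enorm_apply _).trans ((Finset.sum_le_sum fun I _ => ?_).trans
        (hsum (n * (2 ^ n * M) * edist x y ^ ((1 - p⁻¹.toNNReal : ℝ≥0) : ℝ))).le |>.trans
          (le_of_eq ?_))
      · rw [PiLp.sub_apply, happly, happly, ← hM]
        exact enorm_rep_sub_rep_le h hp (hidx I) x y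
      · push_cast; ring
    refine hH.eHolderNorm_le.trans (le_of_eq ?_)
    push_cast; ring

/-! ### Choice of weak derivatives and conclusion -/

lemma exists_isDerivFamily {K : Fin n → ℕ} {p : ℝ≥0∞} {u : RSpace n → ℝ}
    (h : MemMixedSobolev K p u) : ∃ G, IsDerivFamily K u G := by
  have hfin : ∀ α ≤ K, ∃ g, IsWeakDeriv α u g ∧ Measurable g := fun α hα =>
    exists_isWeakDeriv (ENNReal.sum_lt_top.1 h.2 α (Finset.mem_Iic.2 hα))
  choose! G hG using hfin
  exact ⟨G, fun α hα => (hG α hα).1, fun α hα => (hG α hα).2⟩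

lemma IsDerivFamily.mixedSobolevNorm_eq {K : Fin n → ℕ} {u : RSpace n → ℝ}
    {G : (Fin n → ℕ) → RSpace n → ℝ} (h : IsDerivFamily K u G) (p : ℝ≥0∞) :
    mixedSobolevNorm K p u = ∑ β ∈ Finset.Iic K, eLpNorm (G β) p volume :=
  Finset.sum_congr rfl fun α hα => (h.weak α (Finset.mem_Iic.1 hα)).weakDerivNorm_eq p

end DominatingMixed

end

theorem corollary3 (n k : ℕ) (hk : 1 ≤ k) (p : ℝ≥0∞) (hp : 1 ≤ p) :
    ∃ C : ℝ≥0, ∀ u : DominatingMixed.RSpace n → ℝ,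
      DominatingMixed.MemMixedSobolev (fun _ => k) p u →
        ∃ v : DominatingMixed.RSpace n → ℝ, v =ᵐ[volume] u ∧
          DominatingMixed.MemHolderSpace (k - 1) (1 - p⁻¹.toNNReal) v ∧
          DominatingMixed.holderNorm (k - 1) (1 - p⁻¹.toNNReal) v ≤
            C * DominatingMixed.mixedSobolevNorm (fun _ => k) p u := by
  refine ⟨∑ j ∈ Finset.range (k - 1 + 1),
    ((n : ℝ≥0) ^ j * 2 ^ n + (n : ℝ≥0) ^ j * (n * 2 ^ n)), fun u hu => ?_⟩
  obtain ⟨G, hG⟩ := DominatingMixed.exists_isDerivFamily hu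
  have hnorm := hG.mixedSobolevNorm_eq p
  -- The norm is taken as a finite number because `HolderWith` requires a finite constant.
  obtain ⟨M, hM⟩ := WithTop.ne_top_iff_exists.1 hu.2.ne
  have hle := hG.holderNorm_rep_le hk hp (hnorm.symm.trans hM.symm)
  have h0 : (0 : Fin n → ℕ) + 1 ≤ fun _ => k := by
    rw [zero_add]
    exact fun _ => hk
  refine ⟨DominatingMixed.rep G 0, ?_, ⟨?_, ?_⟩, ?_⟩
  · exact (hG.rep_ae_eq h0).trans (hG.weak 0 fun _ => Nat.zero_le k).ae_eq_of_zero
  · exact hG.contDiff_rep (k - 1) (by simp; omega)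
  · exact hle.trans_lt (ENNReal.mul_lt_top ENNReal.coe_lt_top ENNReal.coe_lt_top)
  · rw [← hM]
    exact hle
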